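/- Let $\Sigma_2$ be an alphabet with exactly two letters and let $k \in \mathbb{N}_0$. Two words $u, v \in \Sigma_2^*$ are called Simon $k$-congruent, written $u \sim_k v$, if they have the same scattered factors (that is, not necessarily contiguous subsequences) of length at most $k$. Define integers $c_k^m$ for integers $k$ and $m \ge -1$ by \[ c_k^{-1} := 1, \qquad c_k^0 := 2k+1, \qquad c_k^m := 2(k-m+1)\, c_{k-1}^{m-1} - 2(k-m)\, c_{k-2}^{m-2} \quad (m \ge 1). \] Then the number of congruence classes of $\sim_k$ on $\Sigma_2^*$ is finite and given by \[ |\Sigma_2^*/{\sim_k}| = 1 + \sum_{m=0}^{k-1} c_k^m . \] -/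

import Mathlib

/-- The scattered factors (subsequences) of the word `w` of length at most `k`. -/
def scatFactLE {A : Type*} (k : ℕ) (w : List A) : Set (List A) :=
  {v | v.Sublist w ∧ v.length ≤ k}

/-- Simon's congruence of level `k` on the words over `A`: two words are related iff they have
the same scattered factors of length at most `k`. -/
def simonCongruence (A : Type*) (k : ℕ) : Setoid (List A) where
  r u v := scatFactLE k u = scatFactLE k v
  iseqv := ⟨fun _ => rfl, fun h => h.symm, fun h h' => h.trans h'⟩

theorem simonCongruence_append {A : Type*} {k : ℕ} {u u' v v' : List A}
    (hu : simonCongruence A k u u') (hv : simonCongruence A k v v') :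
    simonCongruence A k (u ++ v) (u' ++ v') := by
  have key : ∀ {u u' v v' : List A}, scatFactLE k u = scatFactLE k u' →
      scatFactLE k v = scatFactLE k v' → scatFactLE k (u ++ v) ⊆ scatFactLE k (u' ++ v') := by
    rintro u u' v v' hu hv w ⟨hw, hl⟩
    obtain ⟨w₁, w₂, rfl, h₁, h₂⟩ := List.sublist_append_iff.1 hw
    rw [List.length_append] at hl
    have h₁' : w₁ ∈ scatFactLE k u' := hu ▸ ⟨h₁, by omega⟩
    have h₂' : w₂ ∈ scatFactLE k v' := hv ▸ ⟨h₂, by omega⟩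
    exact ⟨h₁'.1.append h₂'.1, by rw [List.length_append]; exact hl⟩
  exact Set.Subset.antisymm (key hu hv) (key hu.symm hv.symm)

/-- The numbers `c_k^m` with the upper index shifted by one: `simonCoeffAux n k` is `c_k^(n-1)`. -/
def simonCoeffAux : ℕ → ℤ → ℤ
  | 0, _ => 1
  | 1, k => 2 * k + 1
  | n + 2, k =>
      2 * (k - (n + 1) + 1) * simonCoeffAux (n + 1) (k - 1)
        - 2 * (k - (n + 1)) * simonCoeffAux n (k - 2)

/-- The numbers `c_k^m` for `m ≥ -1`, given by `c_k^(-1) = 1`, `c_k^0 = 2 k + 1` and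
`c_k^m = 2 (k - m + 1) c_(k-1)^(m-1) - 2 (k - m) c_(k-2)^(m-2)` for `m ≥ 1`; the three
equations are the lemmas below. -/
def simonCoeff (k m : ℤ) : ℤ := simonCoeffAux (m + 1).toNat k

theorem simonCoeff_neg_one (k : ℤ) : simonCoeff k (-1) = 1 := by
  simp [simonCoeff, simonCoeffAux]

theorem simonCoeff_zero (k : ℤ) : simonCoeff k 0 = 2 * k + 1 := by
  simp [simonCoeff, simonCoeffAux]

theorem simonCoeff_of_one_le (k m : ℤ) (hm : 1 ≤ m) :
    simonCoeff k m = 2 * (k - m + 1) * simonCoeff (k - 1) (m - 1)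
      - 2 * (k - m) * simonCoeff (k - 2) (m - 2) := by
  obtain ⟨n, rfl⟩ : ∃ n : ℕ, m = n + 1 := ⟨(m - 1).toNat, by omega⟩
  have h₁ : ((n : ℤ) + 1 + 1).toNat = n + 2 := by omega
  have h₂ : ((n : ℤ) + 1 - 1 + 1).toNat = n + 1 := by omega
  have h₃ : ((n : ℤ) + 1 - 2 + 1).toNat = n := by omega
  rw [simonCoeff, simonCoeff, simonCoeff, h₁, h₂, h₃, simonCoeffAux]

/-! Every binary word is an alternating product `s₀ β₁ s₁ ⋯ βₙ sₙ` of unary words and links, built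
so that each `sᵢ₋₁ βᵢ` is an arch read from the left and each `βᵢ sᵢ` an arch read from the right:
both letters occur, the final one in reading order only once. Then `n` is the largest number for
which the word is `n`-universal. The `k`-universal words form one class, the summand 1.

For `n < k` put `K = k - n`. The contexts of a unary factor are `i`- and `(n - i)`-universal, so its
length matters only up to `K` (`exists_normalForm`). Conversely, the arches on each side contain a
word that uses them up, so the scattered factors of length at most `k` determine whatever lies
between up to `K`-congruence (`congr_of_sandwich`), hence every truncated factor
(`eq_of_mem_normalForms`). It remains to count the products with all factors of length at most `K`,
by a two-state transfer matrix. -/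

namespace Simon

open List

/-! ### Universal words -/

/-- A word is `n`-universal if every word of length at most `n` is a scattered factor of it. -/
def Universal (n : ℕ) (x : List Bool) : Prop := ∀ t : List Bool, t.length ≤ n → t <+ x

theorem Universal.mono {m n : ℕ} {x : List Bool} (h : Universal n x) (hmn : m ≤ n) :
    Universal m x := fun t ht => h t (ht.trans hmn)

theorem Universal.append_right {n : ℕ} {x : List Bool} (h : Universal n x) (y : List Bool) :
    Universal n (x ++ y) := fun t ht => (h t ht).trans (sublist_append_left x y)

theorem Universal.append_left {n : ℕ} {x : List Bool} (h : Universal n x) (y : List Bool) :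
    Universal n (y ++ x) := fun t ht => (h t ht).trans (sublist_append_right y x)

theorem universal_zero (x : List Bool) : Universal 0 x := fun t ht => by
  rw [List.length_eq_zero_iff.1 (Nat.le_zero.1 ht)]; exact nil_sublist x

theorem Universal.append_arch {n : ℕ} {x v : List Bool} (h : Universal n x) (hv : ∀ c, c ∈ v) :
    Universal (n + 1) (x ++ v) := by
  intro t ht
  rcases t.eq_nil_or_concat with rfl | ⟨t', c, rfl⟩
  · exact nil_sublist _
  · rw [concat_eq_append] at ht ⊢
    rw [length_append, length_singleton] at ht
    exact (h t' (by omega)).append (singleton_sublist.2 (hv c))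

theorem Universal.arch_append {n : ℕ} {x v : List Bool} (h : Universal n x) (hv : ∀ c, c ∈ v) :
    Universal (n + 1) (v ++ x) := by
  intro t ht
  cases t with
  | nil => exact nil_sublist _
  | cons c t =>
    rw [length_cons] at ht
    exact (singleton_sublist.2 (hv c)).append (h t (by omega))

theorem exists_universal (n : ℕ) : ∃ x, Universal n x := by
  induction n with
  | zero => exact ⟨[], universal_zero _⟩
  | succ n ih =>
    obtain ⟨x, hx⟩ := ih
    exact ⟨x ++ [true, false], hx.append_arch (by simp)⟩

theorem Universal.of_congr {n k : ℕ} {x y : List Bool} (h : Universal n x) (hn : n ≤ k)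
    (hxy : simonCongruence Bool k x y) : Universal n y := fun t ht =>
  ((Set.ext_iff.1 hxy t).1 ⟨h t ht, ht.trans hn⟩).1

theorem Universal.congr {k : ℕ} {x y : List Bool} (hx : Universal k x) (hy : Universal k y) :
    simonCongruence Bool k x y :=
  Set.ext fun t => ⟨fun ht => ⟨hy t ht.2, ht.2⟩, fun ht => ⟨hx t ht.2, ht.2⟩⟩

/-! ### Contexts with a tight scattered factor -/

theorem sublist_of_cons_sublist {e : Bool} {v t z : List Bool} (he : e ∉ v)
    (h : e :: t <+ v ++ e :: z) : t <+ z := by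
  induction v with
  | nil => exact h.of_cons_cons
  | cons a v ih =>
    rw [mem_cons, not_or] at he
    rw [cons_append, cons_sublist_cons'] at h
    exact ih he.2 (h.resolve_right fun h' => he.1 h'.1)

theorem sublist_of_concat_sublist {e : Bool} {v t z : List Bool} (he : e ∉ v)
    (h : t ++ [e] <+ z ++ e :: v) : t <+ z := by
  have h' := h.reverse
  simp only [reverse_append, reverse_cons, reverse_nil, nil_append, append_assoc,
    singleton_append] at h'
  exact reverse_sublist.1 (sublist_of_cons_sublist (by simpa using he) h')

/-- `x` is `n`-universal, and some word of length `n` occurs in `x` but in no shorter prefix. -/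
def LeftTight (n : ℕ) (x : List Bool) : Prop :=
  Universal n x ∧ ∃ p : List Bool, p.length = n ∧ ∀ t z, p ++ t <+ x ++ z → t <+ z

/-- `y` is `n`-universal, and some word of length `n` occurs in `y` but in no shorter suffix. -/
def RightTight (n : ℕ) (y : List Bool) : Prop :=
  Universal n y ∧ ∃ q : List Bool, q.length = n ∧ ∀ t z, t ++ q <+ z ++ y → t <+ z

theorem leftTight_nil : LeftTight 0 [] := ⟨universal_zero _, [], rfl, fun _ _ h => h⟩

theorem rightTight_nil : RightTight 0 [] :=
  ⟨universal_zero _, [], rfl, fun _ _ h => by simpa using h⟩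

theorem LeftTight.append {n : ℕ} {x v : List Bool} {e : Bool} (hx : LeftTight n x) (he : e ∉ v)
    (hv : ∀ c, c ∈ v ++ [e]) : LeftTight (n + 1) (x ++ (v ++ [e])) := by
  obtain ⟨hu, p, hp, h⟩ := hx
  refine ⟨hu.append_arch hv, p ++ [e], by simp [hp], fun t z htz => ?_⟩
  simp only [append_assoc, singleton_append] at htz
  exact sublist_of_cons_sublist he (h _ _ htz)

theorem RightTight.append {n : ℕ} {y v : List Bool} {e : Bool} (hy : RightTight n y) (he : e ∉ v)
    (hv : ∀ c, c ∈ e :: v) : RightTight (n + 1) ((e :: v) ++ y) := by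
  obtain ⟨hu, q, hq, h⟩ := hy
  refine ⟨hu.arch_append hv, e :: q, by simp [hq], fun t z htz => ?_⟩
  have := h (t ++ [e]) (z ++ e :: v) (by simpa using htz)
  exact sublist_of_concat_sublist he this

/-- Pad `t` to `p ++ (t ++ q)`. Universality alone embeds the padding in the primed contexts;
tightness of the unprimed ones then forces `t` into `z`. -/
theorem sandwich_subset {i n j k : ℕ} {x x' y y' z z' : List Bool} (hx : LeftTight i x)
    (hx' : Universal i x') (hy : RightTight n y) (hy' : Universal n y') (hk : i + n + j ≤ k)
    (h : simonCongruence Bool k (x ++ (z ++ y)) (x' ++ (z' ++ y'))) :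
    scatFactLE j z' ⊆ scatFactLE j z := by
  rintro t ⟨ht, htj⟩
  obtain ⟨-, p, hp, hp'⟩ := hx
  obtain ⟨-, q, hq, hq'⟩ := hy
  have h1 : p ++ (t ++ q) ∈ scatFactLE k (x' ++ (z' ++ y')) :=
    ⟨(hx' p hp.le).append (ht.append (hy' q hq.le)), by simp only [length_append]; omega⟩
  exact ⟨hq' _ _ (hp' _ _ ((Set.ext_iff.1 h _).2 h1).1), htj⟩

theorem congr_of_sandwich {i n j k : ℕ} {x x' y y' z z' : List Bool} (hx : LeftTight i x)
    (hx' : LeftTight i x') (hy : RightTight n y) (hy' : RightTight n y') (hk : i + n + j ≤ k)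
    (h : simonCongruence Bool k (x ++ (z ++ y)) (x' ++ (z' ++ y'))) :
    simonCongruence Bool j z z' :=
  Set.Subset.antisymm (sandwich_subset hx' hx.1 hy' hy.1 hk (Setoid.symm' _ h))
    (sandwich_subset hx hx'.1 hy hy'.1 hk h)

theorem eq_of_congr {j : ℕ} {z z' : List Bool} (h : simonCongruence Bool j z z')
    (hz : z.length ≤ j) (hz' : z'.length ≤ j) : z = z' :=
  ((Set.ext_iff.1 h z).1 ⟨Sublist.refl z, hz⟩).1.antisymm
    ((Set.ext_iff.1 h z').2 ⟨Sublist.refl z', hz'⟩).1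

/-! ### Deleting a letter -/

/-- Split a factor of `u a v` at the border of `v`. If the left piece has length at most `p`, it
already lies in `u`. Otherwise at least `p` letters are matched inside `u`, and the at most `q`
remaining ones fit into `v`. -/
theorem congr_insert {p q k : ℕ} {u v : List Bool} {a : Bool}
    (hu : simonCongruence Bool p u (u ++ [a])) (hv : Universal q v) (hk : k ≤ p + q) :
    simonCongruence Bool k (u ++ v) (u ++ [a] ++ v) := by
  refine Set.ext fun t => ⟨fun ht => ⟨ht.1.trans ?_, ht.2⟩, fun ht => ⟨?_, ht.2⟩⟩
  · rw [append_assoc]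
    exact (Sublist.refl u).append (sublist_append_right _ _)
  · obtain ⟨ht, htk⟩ := ht
    obtain ⟨s, r, rfl, hs, hr⟩ := sublist_append_iff.1 ht
    rw [length_append] at htk
    by_cases hsp : s.length ≤ p
    · exact ((Set.ext_iff.1 hu s).2 ⟨hs, hsp⟩).1.append hr
    · obtain ⟨s₁, s₂, rfl, hs₁, hs₂⟩ := sublist_append_iff.1 hs
      have h2 := hs₂.length_le
      rw [length_singleton] at h2
      rw [length_append] at htk hsp
      rw [append_assoc]
      exact hs₁.append (hv _ (by rw [length_append]; omega))

/-- Stripping a letter matched to the last `a` shortens the factor by one, which pays for lowering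
`j`; at `j = 0` universality suffices. -/
theorem congr_concat_replicate {i : ℕ} {x : List Bool} (hx : Universal i x) (a : Bool) (j : ℕ) :
    simonCongruence Bool (i + j) (x ++ replicate j a) (x ++ replicate j a ++ [a]) := by
  induction j with
  | zero => exact ((hx.append_right _).congr ((hx.append_right _).append_right _))
  | succ j ih =>
    refine Set.ext fun t => ⟨fun ht => ⟨ht.1.trans (sublist_append_left _ _), ht.2⟩,
      fun ht => ⟨?_, ht.2⟩⟩
    obtain ⟨ht, htl⟩ := ht
    obtain ⟨s, r, rfl, hs, hr⟩ := sublist_append_iff.1 ht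
    rcases r with - | ⟨b, r⟩
    · simpa using hs
    · have hb : b :: r = [a] := hr.eq_of_length_le (by simp)
      rw [hb] at htl ⊢
      rw [length_append, length_singleton] at htl
      rw [replicate_succ', ← append_assoc] at hs ⊢
      exact ((Set.ext_iff.1 ih s).2 ⟨hs, by omega⟩).1.append (Sublist.refl _)

theorem congr_replicate_of_le {i n K k j : ℕ} {x y : List Bool} (hx : Universal i x)
    (hy : Universal n y) (hk : k ≤ i + K + n) (a : Bool) (hj : K ≤ j) :
    simonCongruence Bool k (x ++ (replicate j a ++ y)) (x ++ (replicate K a ++ y)) := by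
  induction j, hj using Nat.le_induction with
  | base => exact Setoid.refl' _ _
  | succ j hj ih =>
    refine Setoid.trans' _ (Setoid.symm' _ ?_) ih
    have := congr_insert (k := k) (congr_concat_replicate hx a j) hy (by omega)
    simpa [replicate_succ'] using this

/-! ### The factorization of binary words -/

/-- Unary words: `none` is the empty word, `some (c, j)` is `c ^ (j + 1)`. -/
abbrev Unary := Option (Bool × ℕ)

/-- The word denoted by an element of `Unary`. -/
def Unary.word : Unary → List Bool
  | none => []
  | some (c, j) => replicate (j + 1) c

/-- The words that may stand between two given unary words in a factorization. -/
def links : Unary → Unary → Finset (List Bool)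
  | none, none => {[true, false], [false, true]}
  | none, some (c, _) => {[!c, c]}
  | some (c, _), none => {[c, !c]}
  | some (c, _), some (d, _) => if c = d then {[!c]} else {[c, d]}

/-- `Factors n s w`: the word `w` is an alternating product of `n + 1` unary words, the first of
which is `s`, and of `n` links. -/
inductive Factors : ℕ → Unary → List Bool → Prop
  | unary (s : Unary) : Factors 0 s s.word
  | link {n : ℕ} {s s' : Unary} {β w : List Bool} :
      β ∈ links s s' → Factors n s' w → Factors (n + 1) s (s.word ++ (β ++ w))

theorem links_left {s s' : Unary} {β : List Bool} (h : β ∈ links s s') :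
    ∃ v e, s.word ++ β = v ++ [e] ∧ e ∉ v ∧ ∀ c, c ∈ v ++ [e] := by
  rcases s with - | ⟨c, i⟩ <;> rcases s' with - | ⟨d, j⟩
  · simp only [links, Finset.mem_insert, Finset.mem_singleton] at h
    rcases h with rfl | rfl
    · exact ⟨[true], false, by simp [Unary.word]⟩
    · exact ⟨[false], true, by simp [Unary.word]⟩
  · simp only [links, Finset.mem_singleton] at h
    subst h
    exact ⟨[!d], d, by cases d <;> simp [Unary.word]⟩
  · simp only [links, Finset.mem_singleton] at h
    subst h
    exact ⟨replicate (i + 1) c ++ [c], !c, by cases c <;> simp [Unary.word]⟩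
  · rw [links] at h
    split_ifs at h with hcd
    · rw [Finset.mem_singleton] at h
      subst h
      exact ⟨replicate (i + 1) c, !c, by cases c <;> simp [Unary.word]⟩
    · rw [Finset.mem_singleton] at h
      subst h
      exact ⟨replicate (i + 1) c ++ [c], d, by cases c <;> cases d <;> simp_all [Unary.word]⟩

theorem links_right {s s' : Unary} {β : List Bool} (h : β ∈ links s s') :
    ∃ v e, β ++ s'.word = e :: v ∧ e ∉ v ∧ ∀ c, c ∈ e :: v := by
  rcases s with - | ⟨c, i⟩ <;> rcases s' with - | ⟨d, j⟩
  · simp only [links, Finset.mem_insert, Finset.mem_singleton] at h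
    rcases h with rfl | rfl
    · exact ⟨[false], true, by simp [Unary.word]⟩
    · exact ⟨[true], false, by simp [Unary.word]⟩
  · simp only [links, Finset.mem_singleton] at h
    subst h
    exact ⟨d :: replicate (j + 1) d, !d, by cases d <;> simp [Unary.word]⟩
  · simp only [links, Finset.mem_singleton] at h
    subst h
    exact ⟨[!c], c, by cases c <;> simp [Unary.word]⟩
  · rw [links] at h
    split_ifs at h with hcd
    · rw [Finset.mem_singleton] at h
      subst h
      exact ⟨replicate (j + 1) d, !c, by cases c <;> simp_all [Unary.word]⟩
    · rw [Finset.mem_singleton] at h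
      subst h
      exact ⟨d :: replicate (j + 1) d, c, by cases c <;> cases d <;> simp_all [Unary.word]⟩

theorem Factors.exists_rightTight {n : ℕ} {s : Unary} {w : List Bool} (h : Factors n s w) :
    ∃ y, w = s.word ++ y ∧ RightTight n y := by
  induction h with
  | unary s => exact ⟨[], by simp, rightTight_nil⟩
  | link hβ _ ih =>
    obtain ⟨y, rfl, hy⟩ := ih
    obtain ⟨v, e, hv, he, hc⟩ := links_right hβ
    refine ⟨_, rfl, ?_⟩
    rw [← append_assoc, hv]
    exact hy.append he hc

theorem Factors.universal {n : ℕ} {s : Unary} {w : List Bool} (h : Factors n s w) :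
    Universal n w := by
  obtain ⟨y, rfl, hy⟩ := h.exists_rightTight
  exact hy.1.append_left _

theorem Unary.exists_notMem (s : Unary) : ∃ c, c ∉ s.word := by
  rcases s with - | ⟨c, i⟩
  · exact ⟨true, by simp [Unary.word]⟩
  · exact ⟨!c, by simp [Unary.word]⟩

/-- The tight word `q` uses up all of `y`, so a letter missing from `s` cannot be matched in front
of it. -/
theorem Factors.not_universal {n : ℕ} {s : Unary} {w : List Bool} (h : Factors n s w) :
    ¬ Universal (n + 1) w := by
  intro hu
  obtain ⟨y, rfl, -, q, hq, hy⟩ := h.exists_rightTight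
  obtain ⟨c, hc⟩ := s.exists_notMem
  exact hc (singleton_sublist.1 (hy [c] _ (hu _ (by simp [hq]))))

theorem Factors.index_eq {n n' k : ℕ} {s s' : Unary} {w w' : List Bool} (h : Factors n s w)
    (h' : Factors n' s' w') (hn : n < k) (hw : simonCongruence Bool k w w') : n = n' := by
  have h1 : n' ≤ n := by
    by_contra! hlt
    exact h.not_universal ((h'.universal.mono hlt).of_congr hn (Setoid.symm' _ hw))
  by_contra hne
  have hlt : n' < n := by omega
  exact h'.not_universal ((h.universal.mono hlt).of_congr (by omega) hw)

/-! ### Every binary word has a factorization -/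

/-- The unary word over `c` of the given length. -/
def Unary.pow (c : Bool) : ℕ → Unary
  | 0 => none
  | j + 1 => some (c, j)

theorem Unary.word_pow (c : Bool) (j : ℕ) : (Unary.pow c j).word = replicate j c := by
  cases j <;> rfl

/-- The new letter lengthens the first unary word. If that word was empty, the link may no longer
fit; it is then `[!c, c]`, and its `c` is passed on to the next unary word, whence the induction. -/
theorem Factors.cons {n : ℕ} {s : Unary} {w : List Bool} (h : Factors n s w) (c : Bool) (j : ℕ)
    (hs : s = Unary.pow c j) : Factors n (Unary.pow c (j + 1)) (c :: w) := by
  induction h generalizing j with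
  | unary s =>
    subst hs
    rw [show c :: (Unary.pow c j).word = (Unary.pow c (j + 1)).word by
      rw [Unary.word_pow, Unary.word_pow, replicate_succ]]
    exact .unary _
  | @link n s s' β w hβ hw ih =>
    subst hs
    have key : ∀ {β}, β ∈ links (Unary.pow c (j + 1)) s' →
        Factors (n + 1) (Unary.pow c (j + 1)) (c :: ((Unary.pow c j).word ++ (β ++ w))) := by
      intro β hβ
      have := Factors.link hβ hw
      rwa [Unary.word_pow, replicate_succ, cons_append, ← Unary.word_pow] at this
    cases j with
    | succ j => exact key (by rcases s' with - | ⟨d, i⟩ <;> exact hβ)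
    | zero =>
      rcases s' with - | ⟨d, i⟩
      · by_cases hβc : β = [c, !c]
        · exact key (by simp [links, Unary.pow, hβc])
        · have hβ' : β = [!c, c] := by
            cases c <;> simp_all [links, Unary.pow]
          have := Factors.link (s := Unary.pow c 1) (β := [!c]) (by simp [links, Unary.pow])
            (ih 0 rfl)
          simpa [hβ', Unary.pow, Unary.word] using this
      · by_cases hdc : d = c
        · subst hdc
          have hβ' : β = [!d, d] := by simpa [links, Unary.pow] using hβ
          have := Factors.link (s := Unary.pow d 1) (β := [!d]) (by simp [links, Unary.pow])
            (ih (i + 1) rfl)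
          simpa [hβ', Unary.pow, Unary.word] using this
        · refine key ?_
          cases c <;> cases d <;> simp_all [links, Unary.pow]

/-- Inverse move to `Factors.cons`: if the first unary word becomes empty, a link `[!d]` has to
borrow a `d` from the next one. -/
theorem Factors.tail {n : ℕ} {s : Unary} {w : List Bool} (h : Factors n s w) (d : Bool) (j : ℕ)
    (hs : s = Unary.pow d (j + 1)) : ∃ w', w = d :: w' ∧ Factors n (Unary.pow d j) w' := by
  induction h generalizing j with
  | unary s =>
    subst hs
    exact ⟨(Unary.pow d j).word, by rw [Unary.word_pow, Unary.word_pow, replicate_succ], .unary _⟩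
  | @link n s s' β w hβ hw ih =>
    subst hs
    have key : β ∈ links (Unary.pow d j) s' → ∃ w',
        (Unary.pow d (j + 1)).word ++ (β ++ w) = d :: w' ∧
          Factors (n + 1) (Unary.pow d j) w' := fun hβ' =>
      ⟨_, by rw [Unary.word_pow, replicate_succ, cons_append, ← Unary.word_pow],
        Factors.link hβ' hw⟩
    cases j with
    | succ j => exact key (by rcases s' with - | ⟨d, i⟩ <;> exact hβ)
    | zero =>
      rcases s' with - | ⟨c, i⟩
      · refine key ?_
        cases d <;> simp_all [links, Unary.pow]
      · by_cases hdc : d = c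
        · subst hdc
          obtain ⟨w', rfl, hw'⟩ := ih i rfl
          have hβ' : β = [!d] := by simpa [links, Unary.pow] using hβ
          refine ⟨_, by simp [hβ', Unary.pow, Unary.word],
            Factors.link (s := none) (β := [!d, d]) ?_ hw'⟩
          cases i <;> cases d <;> simp [links, Unary.pow]
        · refine key ?_
          cases c <;> cases d <;> simp_all [links, Unary.pow]

theorem exists_factors (w : List Bool) : ∃ n s, Factors n s w := by
  induction w with
  | nil => exact ⟨0, none, .unary none⟩
  | cons c w ih =>
    obtain ⟨n, s, h⟩ := ih
    rcases s with - | ⟨d, j⟩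
    · exact ⟨_, _, h.cons c 0 rfl⟩
    · by_cases hdc : d = c
      · subst hdc
        exact ⟨_, _, h.cons d (j + 1) rfl⟩
      · obtain ⟨w', rfl, hw'⟩ := h.tail d j rfl
        refine ⟨n + 1, none, Factors.link (s := none) (β := [c, d]) ?_ hw'⟩
        cases j <;> cases c <;> cases d <;> simp_all [links, Unary.pow]

/-! ### Normal forms -/

/-- The unary words of length at most `K`. -/
def unaries (K : ℕ) : Finset Unary := Finset.insertNone (Finset.univ ×ˢ Finset.range K)

/-- The words with a factorization into `n + 1` unary words, the first being `s` and the others of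
length at most `K`, and `n` links. -/
def normalForms (K : ℕ) : ℕ → Unary → Finset (List Bool)
  | 0, s => {s.word}
  | n + 1, s => (unaries K).biUnion fun s' => (links s s').biUnion fun β =>
      (normalForms K n s').image fun w => s.word ++ (β ++ w)

theorem mem_normalForms_succ {K n : ℕ} {s : Unary} {w : List Bool} :
    w ∈ normalForms K (n + 1) s ↔ ∃ s' ∈ unaries K, ∃ β ∈ links s s', ∃ w' ∈ normalForms K n s',
      s.word ++ (β ++ w') = w := by
  simp only [normalForms, Finset.mem_biUnion, Finset.mem_image]

theorem factors_of_mem_normalForms {K n : ℕ} {s : Unary} {w : List Bool}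
    (h : w ∈ normalForms K n s) : Factors n s w := by
  induction n generalizing s w with
  | zero =>
    rw [normalForms, Finset.mem_singleton] at h
    exact h ▸ .unary s
  | succ n ih =>
    obtain ⟨s', -, β, hβ, w', hw', rfl⟩ := mem_normalForms_succ.1 h
    exact .link hβ (ih hw')

theorem Unary.length_word_le {K : ℕ} {s : Unary} (hs : s ∈ unaries K) : s.word.length ≤ K := by
  rcases s with - | ⟨c, j⟩
  · simp [Unary.word]
  · simpa [unaries, Unary.word, Nat.succ_le_iff] using hs

theorem Unary.word_injective : Function.Injective Unary.word := by
  rintro (- | ⟨c, i⟩) (- | ⟨d, j⟩) h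
  · rfl
  · simp [Unary.word] at h
  · simp [Unary.word] at h
  · simp only [Unary.word, replicate_inj] at h
    simp_all

theorem first_eq {i n K k : ℕ} {s s' : Unary} {x x' w w' : List Bool} (hx : LeftTight i x)
    (hx' : LeftTight i x') (hs : s ∈ unaries K) (hs' : s' ∈ unaries K) (hw : Factors n s w)
    (hw' : Factors n s' w') (hk : i + n + K ≤ k)
    (h : simonCongruence Bool k (x ++ w) (x' ++ w')) : s = s' := by
  obtain ⟨y, rfl, hy⟩ := hw.exists_rightTight
  obtain ⟨y', rfl, hy'⟩ := hw'.exists_rightTight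
  exact Unary.word_injective (eq_of_congr (congr_of_sandwich hx hx' hy hy' hk h)
    (Unary.length_word_le hs) (Unary.length_word_le hs'))

theorem LeftTight.append_link {i : ℕ} {s s' : Unary} {x β : List Bool} (hx : LeftTight i x)
    (hβ : β ∈ links s s') : LeftTight (i + 1) (x ++ (s.word ++ β)) := by
  obtain ⟨v, e, hv, he, hc⟩ := links_left hβ
  rw [hv]
  exact hx.append he hc

theorem link_eq {i n K k : ℕ} {s t t' : Unary} {x x' w w' β β' : List Bool}
    (hx : LeftTight i x) (hx' : LeftTight i x') (hK : 1 ≤ K)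
    (ht : t ∈ unaries K) (ht' : t' ∈ unaries K) (hβ : β ∈ links s t) (hβ' : β' ∈ links s t')
    (hw : Factors n t w) (hw' : Factors n t' w') (hk : i + (n + 1) + K ≤ k)
    (h : simonCongruence Bool k (x ++ (s.word ++ (β ++ w))) (x' ++ (s.word ++ (β' ++ w')))) :
    t = t' ∧ β = β' := by
  have htt : t = t' := by
    refine first_eq (hx.append_link hβ) (hx'.append_link hβ') ht ht' hw hw' (k := k)
      (by omega) ?_
    simpa using h
  subst htt
  refine ⟨rfl, ?_⟩
  rcases s with - | ⟨c, j⟩ <;> rcases t with - | ⟨d, l⟩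
  · obtain ⟨y, rfl, hy⟩ := hw.exists_rightTight
    obtain ⟨y', rfl, hy'⟩ := hw'.exists_rightTight
    -- Only between two empty words is there a choice of link. Comparing at length 2 is allowed
    -- because `n + 2 ≤ (n + 1) + K`, by `1 ≤ K`.
    have h2 : ∀ γ ∈ links none none, γ.length = 2 := by simp [links]
    refine eq_of_congr (congr_of_sandwich (j := 2) hx hx' hy hy' (by omega) h) (h2 _ hβ).le
      (h2 _ hβ').le
  · simp_all [links]
  · simp_all [links]
  · rw [links] at hβ hβ'
    split_ifs at hβ hβ' <;> simp_all

theorem eq_of_mem_normalForms {i n K k : ℕ} {s s' : Unary} {x x' w w' : List Bool}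
    (hx : LeftTight i x) (hx' : LeftTight i x') (hK : 1 ≤ K) (hs : s ∈ unaries K)
    (hs' : s' ∈ unaries K) (hw : w ∈ normalForms K n s) (hw' : w' ∈ normalForms K n s')
    (hk : i + n + K ≤ k) (h : simonCongruence Bool k (x ++ w) (x' ++ w')) : w = w' := by
  induction n generalizing i s s' x x' w w' with
  | zero =>
    obtain rfl := first_eq hx hx' hs hs' (factors_of_mem_normalForms hw)
      (factors_of_mem_normalForms hw') hk h
    rw [normalForms, Finset.mem_singleton] at hw hw'
    rw [hw, hw']
  | succ n ih =>
    obtain rfl := first_eq hx hx' hs hs' (factors_of_mem_normalForms hw)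
      (factors_of_mem_normalForms hw') hk h
    obtain ⟨t, ht, β, hβ, v, hv, rfl⟩ := mem_normalForms_succ.1 hw
    obtain ⟨t', ht', β', hβ', v', hv', rfl⟩ := mem_normalForms_succ.1 hw'
    obtain ⟨rfl, rfl⟩ := link_eq hx hx' hK ht ht' hβ hβ' (factors_of_mem_normalForms hv)
      (factors_of_mem_normalForms hv') hk h
    rw [ih (hx.append_link hβ) (hx'.append_link hβ) ht ht hv hv' (by omega) (by simpa using h)]

/-- Cut a unary word down to length at most `K`. -/
def Unary.trunc (K : ℕ) : Unary → Unary
  | none => none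
  | some (c, j) => some (c, min j (K - 1))

theorem Unary.trunc_mem {K : ℕ} (hK : 1 ≤ K) (s : Unary) : s.trunc K ∈ unaries K := by
  rcases s with - | ⟨c, j⟩
  · simp [unaries, Unary.trunc]
  · simp [unaries, Unary.trunc]; omega

/-- Links depend only on emptiness and on the letter, and truncation preserves both. -/
theorem links_trunc (K : ℕ) (s s' : Unary) : links (s.trunc K) (s'.trunc K) = links s s' := by
  rcases s with - | ⟨c, i⟩ <;> rcases s' with - | ⟨d, j⟩ <;> rfl

theorem congr_trunc {i n K k : ℕ} {x y : List Bool} (hK : 1 ≤ K) (hx : Universal i x)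
    (hy : Universal n y) (hk : k ≤ i + K + n) (s : Unary) :
    simonCongruence Bool k (x ++ (s.word ++ y)) (x ++ ((s.trunc K).word ++ y)) := by
  rcases s with - | ⟨c, j⟩
  · exact Setoid.refl' _ _
  · simp only [Unary.word, Unary.trunc]
    rcases le_total j (K - 1) with h | h
    · rw [min_eq_left h]
    · rw [min_eq_right h, Nat.sub_add_cancel hK]
      exact congr_replicate_of_le hx hy hk c (by omega)

theorem exists_normalForm {i n K k : ℕ} {s : Unary} {x w : List Bool} (hK : 1 ≤ K)
    (hx : Universal i x) (hw : Factors n s w) (hk : k ≤ i + n + K) :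
    ∃ w' ∈ normalForms K n (s.trunc K), simonCongruence Bool k (x ++ w) (x ++ w') := by
  induction hw generalizing i x with
  | unary s =>
    refine ⟨(s.trunc K).word, by simp [normalForms], ?_⟩
    simpa using congr_trunc hK hx (universal_zero []) (by omega) s
  | @link n s s' β w hβ hw ih =>
    have hβ' : β ∈ links (s.trunc K) (s'.trunc K) := by rwa [links_trunc]
    obtain ⟨v, e, hv, -, hc⟩ := links_left hβ'
    obtain ⟨w', hw', hww'⟩ := ih (hx.append_arch (v := (s.trunc K).word ++ β) (hv ▸ hc))
      (by omega)
    refine ⟨_, mem_normalForms_succ.2 ⟨_, Unary.trunc_mem hK s', β, hβ', w', hw', rfl⟩, ?_⟩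
    obtain ⟨y, hy, hyt⟩ := (Factors.link hβ hw).exists_rightTight
    -- All `n + 1` arches read from the right lie after `s`.
    have hu : Universal (n + 1) (β ++ w) := append_cancel_left hy ▸ hyt.1
    refine Setoid.trans' _ (congr_trunc hK hx hu (by omega) s) ?_
    simpa using hww'

/-! ### Counting normal forms -/

theorem card_normalForms_succ {K n : ℕ} (hK : 1 ≤ K) (s : Unary) :
    (normalForms K (n + 1) s).card =
      ∑ s' ∈ unaries K, (links s s').card * (normalForms K n s').card := by
  -- Equal words are congruent, so with empty contexts `link_eq` also gives uniqueness of the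
  -- factorization.
  have key : ∀ t ∈ unaries K, ∀ t' ∈ unaries K, ∀ β ∈ links s t, ∀ β' ∈ links s t',
      ∀ w ∈ normalForms K n t, ∀ w' ∈ normalForms K n t',
        s.word ++ (β ++ w) = s.word ++ (β' ++ w') → t = t' ∧ β = β' :=
    fun t ht t' ht' β hβ β' hβ' w hw w' hw' h =>
      link_eq (k := 0 + (n + 1) + K) leftTight_nil leftTight_nil hK ht ht' hβ hβ'
        (factors_of_mem_normalForms hw) (factors_of_mem_normalForms hw') le_rfl
        (by rw [h])
  rw [normalForms, Finset.card_biUnion]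
  · refine Finset.sum_congr rfl fun t ht => ?_
    rw [Finset.card_biUnion, Finset.sum_const_nat]
    · intro β _
      exact Finset.card_image_of_injective _ fun w w' h =>
        append_cancel_left (append_cancel_left h)
    · intro β hβ β' hβ' hne
      refine Finset.disjoint_left.2 ?_
      intro u hu hu'
      obtain ⟨w, hw, rfl⟩ := Finset.mem_image.1 hu
      obtain ⟨w', hw', h⟩ := Finset.mem_image.1 hu'
      exact hne (key t ht t ht β hβ β' hβ' w hw w' hw' h.symm).2
  · intro t ht t' ht' hne
    refine Finset.disjoint_left.2 ?_
    intro u hu hu'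
    simp only [Finset.mem_biUnion, Finset.mem_image] at hu hu'
    obtain ⟨β, hβ, w, hw, rfl⟩ := hu
    obtain ⟨β', hβ', w', hw', h⟩ := hu'
    exact hne (key t ht t' ht' β hβ β' hβ' w hw w' hw' h.symm).1

theorem sum_unaries {M : Type*} [AddCommMonoid M] (K : ℕ) (f : Unary → M) :
    ∑ s ∈ unaries K, f s =
      f none + ∑ j ∈ Finset.range K, (f (some (true, j)) + f (some (false, j))) := by
  rw [unaries, Finset.sum_insertNone, Finset.sum_product_right]
  simp

/-- The numbers of normal forms with empty, respectively nonempty, first unary word. -/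
def counts (K : ℕ) : ℕ → ℕ × ℕ
  | 0 => (1, 1)
  | n + 1 => (2 * (counts K n).1 + 2 * K * (counts K n).2, (counts K n).1 + 2 * K * (counts K n).2)

theorem card_normalForms {K : ℕ} (hK : 1 ≤ K) (n : ℕ) :
    (normalForms K n none).card = (counts K n).1 ∧
      ∀ c j, (normalForms K n (some (c, j))).card = (counts K n).2 := by
  induction n with
  | zero => simp [normalForms, counts]
  | succ n ih =>
    refine ⟨?_, fun c j => ?_⟩
    · rw [card_normalForms_succ hK, sum_unaries]
      simp [links, ih.1, ih.2, counts]
      ring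
    · rw [card_normalForms_succ hK, sum_unaries]
      have : ∀ d l, (links (some (c, j)) (some (d, l))).card = 1 := by
        intro d l
        rw [links]
        split_ifs <;> simp
      simp [links.eq_3, this, ih.1, ih.2, counts]
      ring

/-- The recursion for `c_k^m` keeps `K = k - m` fixed, so its coefficients `2 (K + 1)` and `2 K` are
constant: they are the trace and the determinant of the transfer matrix in `counts`
(Cayley–Hamilton). -/
theorem counts_eq_simonCoeffAux (K n : ℕ) :
    ((counts K n).1 + 2 * K * (counts K n).2 : ℤ) = simonCoeffAux (n + 1) (n + K) := by
  induction n using Nat.twoStepInduction with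
  | zero => simp [counts, simonCoeffAux]; ring
  | one => simp [counts, simonCoeffAux]; ring
  | more n ih₁ ih₂ =>
    have e₁ : ((n + 2 : ℕ) : ℤ) + K - 1 = ((n + 1 : ℕ) : ℤ) + K := by push_cast; ring
    have e₂ : ((n + 2 : ℕ) : ℤ) + K - 2 = (n : ℤ) + K := by push_cast; ring
    rw [simonCoeffAux, e₁, e₂, ← ih₁, ← ih₂]
    simp only [counts]
    push_cast
    ring

/-- The normal forms with `n` links and unary words of length at most `K`. -/
def allNormalForms (K n : ℕ) : Finset (List Bool) := (unaries K).biUnion (normalForms K n)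

theorem card_allNormalForms {K : ℕ} (hK : 1 ≤ K) (n : ℕ) :
    ((allNormalForms K n).card : ℤ) = simonCoeff (n + K) n := by
  have h : (allNormalForms K n).card = (counts K n).1 + 2 * K * (counts K n).2 := by
    rw [allNormalForms, Finset.card_biUnion, sum_unaries]
    · simp [card_normalForms hK n]
      ring
    · intro s hs s' hs' hne
      refine Finset.disjoint_left.2 ?_
      intro w hw hw'
      exact hne (first_eq (k := 0 + n + K) leftTight_nil leftTight_nil hs hs'
        (factors_of_mem_normalForms hw) (factors_of_mem_normalForms hw') le_rfl (Setoid.refl' _ _))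
  rw [h, simonCoeff, show ((n : ℤ) + 1).toNat = n + 1 by omega, ← counts_eq_simonCoeffAux]
  push_cast
  ring

theorem exists_factors_of_mem {K n : ℕ} {w : List Bool} (h : w ∈ allNormalForms K n) :
    ∃ s ∈ unaries K, w ∈ normalForms K n s ∧ Factors n s w := by
  obtain ⟨s, hs, hw⟩ := Finset.mem_biUnion.1 h
  exact ⟨s, hs, hw, factors_of_mem_normalForms hw⟩

/-! ### Representatives for all classes over `Bool` -/

theorem finite_and_card_bool (k : ℕ) :
    Finite (Quotient (simonCongruence Bool k)) ∧
      (Nat.card (Quotient (simonCongruence Bool k)) : ℤ) =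
        1 + ∑ m ∈ Finset.range k, simonCoeff k m := by
  obtain ⟨u, hu⟩ := exists_universal k
  -- `u` represents the class of `k`-universal words, `N` the classes of universality index `m < k`,
  -- each with its own bound `k - m ≥ 1`.
  set N := (Finset.range k).biUnion fun m => allNormalForms (k - m) m with hN
  have huN : ∀ w ∈ N, ¬ Universal k w := by
    intro w hw huw
    obtain ⟨m, hm, hw⟩ := Finset.mem_biUnion.1 hw
    obtain ⟨s, -, -, hf⟩ := exists_factors_of_mem hw
    exact hf.not_universal (huw.mono (Finset.mem_range.1 hm))
  have hinj : ∀ w ∈ insert u N, ∀ w' ∈ insert u N, simonCongruence Bool k w w' → w = w' := by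
    intro w hw w' hw' h
    rcases Finset.mem_insert.1 hw with rfl | hwN <;> rcases Finset.mem_insert.1 hw' with rfl | hwN'
    · rfl
    · exact (huN w' hwN' (hu.of_congr le_rfl h)).elim
    · exact (huN w hwN (hu.of_congr le_rfl (Setoid.symm' _ h))).elim
    · obtain ⟨m, hm, hw⟩ := Finset.mem_biUnion.1 hwN
      obtain ⟨m', hm', hw'⟩ := Finset.mem_biUnion.1 hwN'
      obtain ⟨s, hs, hws, hf⟩ := exists_factors_of_mem hw
      obtain ⟨s', hs', hws', hf'⟩ := exists_factors_of_mem hw'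
      rw [Finset.mem_range] at hm
      obtain rfl := hf.index_eq hf' hm h
      exact eq_of_mem_normalForms leftTight_nil leftTight_nil (by omega) hs hs' hws hws'
        (by omega) h
  have hsurj : ∀ w, ∃ w' ∈ insert u N, simonCongruence Bool k w' w := by
    intro w
    obtain ⟨n, s, hf⟩ := exists_factors w
    by_cases hn : n < k
    · obtain ⟨w', hw', h⟩ := exists_normalForm (k := k) (K := k - n) (by omega)
        (universal_zero []) hf (by omega)
      exact ⟨w', Finset.mem_insert_of_mem (Finset.mem_biUnion.2 ⟨n, Finset.mem_range.2 hn,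
        Finset.mem_biUnion.2 ⟨_, Unary.trunc_mem (by omega) s, hw'⟩⟩), Setoid.symm' _ h⟩
    · exact ⟨u, Finset.mem_insert_self _ _, hu.congr (hf.universal.mono (by omega))⟩
  have hbij : Function.Bijective
      fun w : (insert u N : Finset (List Bool)) => Quotient.mk (simonCongruence Bool k) w.1 := by
    refine ⟨fun w w' h => Subtype.ext (hinj _ w.2 _ w'.2 (Quotient.exact h)), fun q => ?_⟩
    induction q using Quotient.inductionOn with
    | h w =>
      obtain ⟨w', hw', h⟩ := hsurj w
      exact ⟨⟨w', hw'⟩, Quotient.sound h⟩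
  refine ⟨Finite.of_surjective _ hbij.2, ?_⟩
  rw [← Nat.card_eq_of_bijective _ hbij, Nat.card_eq_fintype_card, Fintype.card_coe,
    Finset.card_insert_of_notMem fun h => huN u h hu, hN, Finset.card_biUnion]
  · push_cast
    rw [add_comm, Finset.sum_congr rfl]
    intro m hm
    rw [Finset.mem_range] at hm
    rw [card_allNormalForms (by omega), Nat.cast_sub hm.le, add_sub_cancel]
  · intro m hm m' _ hne
    refine Finset.disjoint_left.2 ?_
    intro w hw hw'
    obtain ⟨s, -, -, hf⟩ := exists_factors_of_mem hw
    obtain ⟨s', -, -, hf'⟩ := exists_factors_of_mem hw'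
    exact hne (hf.index_eq hf' (Finset.mem_range.1 hm) (Setoid.refl' _ w))

/-! ### Change of alphabet -/

theorem scatFactLE_map {A B : Type*} (e : A ≃ B) (k : ℕ) (w : List A) :
    scatFactLE k (w.map e) = (List.map e) '' scatFactLE k w := by
  ext t
  constructor
  · rintro ⟨ht, htk⟩
    obtain ⟨t', ht', rfl⟩ := sublist_map_iff.1 ht
    exact ⟨t', ⟨ht', by simpa using htk⟩, rfl⟩
  · rintro ⟨t', ⟨ht', htk⟩, rfl⟩
    exact ⟨ht'.map e, by simpa using htk⟩

/-- A bijection of alphabets induces a bijection of the sets of congruence classes. -/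
def quotientCongr {A B : Type*} (e : A ≃ B) (k : ℕ) :
    Quotient (simonCongruence A k) ≃ Quotient (simonCongruence B k) :=
  Quotient.congr (Equiv.listEquivOfEquiv e) fun u v => by
    change scatFactLE k u = scatFactLE k v ↔ scatFactLE k (u.map e) = scatFactLE k (v.map e)
    rw [scatFactLE_map, scatFactLE_map,
      (Set.image_injective.2 (List.map_injective_iff.2 e.injective)).eq_iff]

end Simon

theorem mainTheorem5 (A : Type*) (hA : Nat.card A = 2) (k : ℕ) :
    Finite (Quotient (simonCongruence A k)) ∧
      (Nat.card (Quotient (simonCongruence A k)) : ℤ) =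
        1 + ∑ m ∈ Finset.range k, simonCoeff k m := by
  have : Finite A := Nat.finite_of_card_ne_zero (by omega)
  have e : A ≃ Bool := (Finite.card_eq.1 (by simp [hA])).some
  obtain ⟨hfin, hcard⟩ := Simon.finite_and_card_bool k
  exact ⟨Finite.of_equiv _ (Simon.quotientCongr e k).symm,
    by rw [Nat.card_congr (Simon.quotientCongr e k), hcard]⟩
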